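/- **Setting.** Identify $\mathbb R^n$ with its dual through the standard inner product. For a set $T\subset\mathbb R^n$ write $\|v\|_T=\max_{p\in T}\langle p,v\rangle$, and let $K^\circ=\{p:\langle p,q\rangle\le 1\ \text{for all } q\in K\}$ be the polar of $K$. *Hanner polytopes* are defined inductively: the segment $[-1,1]\subset\mathbb R^1$ is a Hanner polytope; and if $K\subset\mathbb R^k$ and $L\subset\mathbb R^l$ are Hanner polytopes, which are the unit balls of norms $N_K$ and $N_L$, then the unit balls in $\mathbb R^{k+l}=\mathbb R^k\oplus\mathbb R^l$ of the norms $N_K(x)+N_L(y)$ and $\max\{N_K(x),N_L(y)\}$ are Hanner polytopes. For a Hanner polytope $K$, a point $q\in\partial K$ lies in the smooth piece of $\partial K$ if the norm $\|\cdot\|_{K^\circ}$ (whose unit ball is $K$) is differentiable at $q$; the outer normal is then $n_K(q)=d\|q\|_{K^\circ}$, the differential of that norm at $q$. Note that the polar of a Hanner polytope is a Hanner polytope. Let $H\subset\mathbb R^n$ be a Hanner polytope. A *(closed) classical billiard trajectory in $H$ with geometry specified by $H^\circ$* consists of points $q_i$ in the smooth piece of $\partial H$ and momenta $p_i$ in the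 smooth piece of $\partial H^\circ$, with indices $i\in\mathbb Z/m$, $m\ge1$, such that for every $i$ $$p_{i+1}-p_i=-\lambda_i\, n_H(q_i),\qquad q_{i+1}-q_i=\mu_i\, n_{H^\circ}(p_{i+1})\qquad\text{with some }\lambda_i>0,\ \mu_i>0 .$$ It bounces $m$ times, and its length is $\sum_{i\in\mathbb Z/m}\|q_{i+1}-q_i\|_{H^\circ}$. It is *simple* if it does not pass the same route several times, i.e. there is no $d\not\equiv 0 \pmod m$ with $q_{i+d}=q_i$ and $p_{i+d}=p_i$ for all $i$. **Theorem.** Let $H\subset\mathbb R^n$ be a Hanner polytope. Every simple classical billiard trajectory in $H$ with geometry specified by $H^\circ$ 1. has length $4$; 2. bounces exactly $2n$ times, i.e. $m=2n$; 3. is centrally symmetric with respect to the origin, and so is the corresponding momentum trajectory: $q_i=-q_{i+n}$ and $p_i=-p_{i+n}$ for all $i$ (indices modulo $m=2n$). -/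

import Mathlib

namespace HannerBilliard

noncomputable section

/-- The space `ℝⁿ`. It is identified with its dual space through the standard inner product. -/
abbrev Space (n : ℕ) : Type := EuclideanSpace ℝ (Fin n)

/-- The polar body `K° = {p | ⟨p, q⟩ ≤ 1 for all q ∈ K}`. -/
def polarBody {n : ℕ} (K : Set (Space n)) : Set (Space n) :=
  {p | ∀ q ∈ K, inner ℝ p q ≤ 1}

/-- `‖q‖_T = max_{p ∈ T} ⟨p, q⟩`, the norm whose unit ball is the polar of `T`. -/
def bodyNorm {n : ℕ} (T : Set (Space n)) (q : Space n) : ℝ :=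
  sSup ((fun p : Space n => (inner ℝ p q : ℝ)) '' T)

/-- `q` lies in the smooth piece of the boundary of `K`, and `ν = n_K(q)` is the outer normal there:
the differential at `q` of the norm `‖·‖_{K°}`, whose unit body is `K`. -/
def IsSmoothBoundaryPointWithNormal {n : ℕ} (K : Set (Space n)) (q ν : Space n) : Prop :=
  q ∈ frontier K ∧ HasGradientAt (bodyNorm (polarBody K)) ν q

/-- The first `k` coordinates of a vector of `ℝᵏ⁺ˡ`. -/
def firstPart {k l : ℕ} (x : Space (k + l)) : Space k :=
  WithLp.toLp 2 fun i => x (Fin.castAdd l i)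

/-- The last `l` coordinates of a vector of `ℝᵏ⁺ˡ`. -/
def lastPart {k l : ℕ} (x : Space (k + l)) : Space l :=
  WithLp.toLp 2 fun i => x (Fin.natAdd k i)

/-- `K ⊕₁ L`: the unit body of the sum of the norms with unit bodies `K` and `L`. -/
def sumOne {k l : ℕ} (K : Set (Space k)) (L : Set (Space l)) : Set (Space (k + l)) :=
  {x | gauge K (firstPart x) + gauge L (lastPart x) ≤ 1}

/-- `K ⊕_∞ L`: the unit body of the maximum of the norms with unit bodies `K` and `L`. -/
def sumInfty {k l : ℕ} (K : Set (Space k)) (L : Set (Space l)) : Set (Space (k + l)) :=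
  {x | max (gauge K (firstPart x)) (gauge L (lastPart x)) ≤ 1}

/-- Hanner polytopes: obtained from the segment `[-1, 1] ⊂ ℝ¹` by `ℓ₁`- and `ℓ_∞`-sums. -/
inductive IsHanner : {n : ℕ} → Set (Space n) → Prop
  | segment : IsHanner {x : Space 1 | x 0 ∈ Set.Icc (-1 : ℝ) 1}
  | sumOne {k l : ℕ} {K : Set (Space k)} {L : Set (Space l)} :
      IsHanner K → IsHanner L → IsHanner (sumOne K L)
  | sumInfty {k l : ℕ} {K : Set (Space k)} {L : Set (Space l)} :
      IsHanner K → IsHanner L → IsHanner (sumInfty K L)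

/-- Closed classical billiard trajectories with `m` bounces in the body `K`, with geometry given
by the body `T`. The points `q i` are the consecutive bounce points (indices modulo `m`) and `p i`
is the momentum on the segment that arrives at `q i`, so `p (i + 1)` is the one on the segment from
`q i` to `q (i + 1)`. All coordinates and momenta lie in the smooth pieces of the boundaries.
At each bounce `p' - p = -λ n_K(q)` with `λ > 0`, and between bounces the point moves in the
direction of the velocity `d‖p‖_{T°} = n_T(p)`. -/
structure IsClassicalTrajectory {n m : ℕ} (K T : Set (Space n)) (q p : ZMod m → Space n) :
    Prop where
  momentum_step : ∀ i, ∃ ν : Space n, IsSmoothBoundaryPointWithNormal K (q i) ν ∧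
    ∃ c : ℝ, 0 < c ∧ p (i + 1) - p i = -(c • ν)
  coordinate_step : ∀ i, ∃ v : Space n, IsSmoothBoundaryPointWithNormal T (p (i + 1)) v ∧
    ∃ c : ℝ, 0 < c ∧ q (i + 1) - q i = c • v

/-- A closed trajectory is simple if it does not pass the same route several times: no nontrivial
cyclic shift of the indices maps it (coordinates and momenta) to itself. -/
def IsSimpleTrajectory {n m : ℕ} (q p : ZMod m → Space n) : Prop :=
  ∀ d : ZMod m, (∀ i, q (i + d) = q i ∧ p (i + d) = p i) → d = 0

/-- The length `∑ᵢ ‖q_{i+1} - q_i‖_T` of the closed polygonal line with vertices `q i`. -/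
def trajectoryLength {n m : ℕ} [NeZero m] (T : Set (Space n)) (q : ZMod m → Space n) : ℝ :=
  ∑ i : ZMod m, bodyNorm T (q (i + 1) - q i)

end

end HannerBilliard

namespace HannerBilliard

/-! Induction on the construction of the Hanner polytope, with the dual norms `N`, `N'` of the body
and its polar. The statement that survives the induction, `BounceRigid`, drops simplicity: time
being length, every closed orbit reaches its antipode in the phase space after `n` bounces and time
`2`, and its number of bounces is a multiple of `2n`. Simplicity enters only at the end: the shift
by `2n` fixes the orbit, so `m ∣ 2n`.

For an `ℓ_∞`-sum the body is a product and the momentum norm is a sum, so the velocity splits into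
the velocities of the two parts, running on one clock. Smoothness makes each bounce hit exactly one
factor and leave the other momentum alone, so the norm of each partial momentum is conserved. Each
projection is therefore an orbit of its factor, except that its momentum has norm `e` instead of `1`
and some indices are not bounces; this is why `TimeRigid` speaks of time and counts marked bounces.
After time `2` both projections are antipodal, having bounced `k` and `l` times, hence `k + l` times
together.

An `ℓ₁`-sum is dual to an `ℓ_∞`-sum, and rigidity passes to the dual: `p i` with momentum `-q (i +
1)` is an orbit of the polar body. The two clocks differ by `⟨p, q⟩` up to a constant, and `⟨p, q⟩`
is unchanged under `(q, p) ↦ (-q, -p)`. -/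

/-! ### Dual norms and normals. -/

/-- `ν` is the unique element of the unit ball of `N'` that norms `q`. -/
structure IsNormal {n : ℕ} (N N' : Seminorm ℝ (Space n)) (q ν : Space n) : Prop where
  le_one : N' ν ≤ 1
  inner_eq : inner ℝ ν q = N q
  unique : ∀ g, N' g ≤ 1 → inner ℝ g q = N q → g = ν

/-- Two seminorms that are dual to each other on a space of positive dimension. -/
structure IsDualPair {n : ℕ} (N N' : Seminorm ℝ (Space n)) : Prop where
  pos : 0 < n
  cont : Continuous N
  cont' : Continuous N'
  inner_le : ∀ p q : Space n, inner ℝ p q ≤ N' p * N q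
  attained : ∀ q : Space n, ∃ p : Space n, N' p ≤ 1 ∧ inner ℝ p q = N q
  attained' : ∀ p : Space n, ∃ q : Space n, N q ≤ 1 ∧ inner ℝ q p = N' p

namespace IsDualPair

variable {n : ℕ} {N N' : Seminorm ℝ (Space n)}

theorem symm (h : IsDualPair N N') : IsDualPair N' N where
  pos := h.pos
  cont := h.cont'
  cont' := h.cont
  inner_le p q := by rw [real_inner_comm, mul_comm]; exact h.inner_le q p
  attained := h.attained'
  attained' := h.attained

theorem exists_ne_zero (h : IsDualPair N N') : ∃ p : Space n, p ≠ 0 ∧ N' p ≤ 1 := by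
  let w : Space n := EuclideanSpace.single ⟨0, h.pos⟩ 1
  have hw : w ≠ 0 := by simp [w]
  obtain ⟨p, hp, hpw⟩ := h.attained w
  refine ⟨p, ?_, hp⟩
  rintro rfl
  have h1 := h.inner_le w w
  rw [inner_zero_left] at hpw
  rw [← hpw, mul_zero] at h1
  exact hw (inner_self_eq_zero.1 (le_antisymm h1 real_inner_self_nonneg))

end IsDualPair

namespace IsNormal

variable {n : ℕ} {N N' : Seminorm ℝ (Space n)} {q ν : Space n}

theorem eq {ν' : Space n} (h : IsNormal N N' q ν) (h' : IsNormal N N' q ν') : ν' = ν :=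
  h.unique _ h'.le_one h'.inner_eq

theorem neg (h : IsNormal N N' q ν) : IsNormal N N' (-q) (-ν) where
  le_one := by rw [map_neg_eq_map]; exact h.le_one
  inner_eq := by rw [inner_neg_neg, map_neg_eq_map]; exact h.inner_eq
  unique g hg hgq := by
    rw [← h.unique (-g) (by rwa [map_neg_eq_map])
      (by rw [inner_neg_left, ← inner_neg_right, hgq, map_neg_eq_map]), neg_neg]

theorem smul (h : IsNormal N N' q ν) {c : ℝ} (hc : 0 < c) : IsNormal N N' (c • q) ν where
  le_one := h.le_one
  inner_eq := by
    rw [inner_smul_right, h.inner_eq, map_smul_eq_mul, Real.norm_of_nonneg hc.le]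
  unique g hg hgq := by
    refine h.unique g hg ?_
    rw [inner_smul_right, map_smul_eq_mul, Real.norm_of_nonneg hc.le] at hgq
    exact mul_left_cancel₀ hc.ne' hgq

/-- If `N q = 0`, every `g` in the dual ball norms `q`, against uniqueness, since that ball contains
a nonzero vector. -/
theorem pos (h : IsNormal N N' q ν) (hd : IsDualPair N N') : 0 < N q := by
  refine lt_of_le_of_ne (apply_nonneg N q) fun h0 => ?_
  have hz : ∀ g : Space n, N' g ≤ 1 → g = ν := fun g hg => by
    have h1 := hd.inner_le g q
    have h2 := hd.inner_le (-g) q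
    rw [inner_neg_left] at h2
    rw [← h0, mul_zero] at h1 h2
    exact h.unique g hg (by linarith)
  obtain ⟨w, hw, hw1⟩ := hd.exists_ne_zero
  exact hw ((hz w hw1).trans (hz 0 (by simp)).symm)

theorem eq_one (h : IsNormal N N' q ν) (hd : IsDualPair N N') : N' ν = 1 := by
  refine le_antisymm h.le_one ?_
  have h1 := hd.inner_le ν q
  rw [h.inner_eq] at h1
  exact le_of_mul_le_mul_right (by linarith) (h.pos hd)

theorem ne_zero (h : IsNormal N N' q ν) (hd : IsDualPair N N') : ν ≠ 0 := by
  rintro rfl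
  simpa using h.eq_one hd

end IsNormal

/-! ### Orbits and the two forms of rigidity. -/

/-- Periodic billiard orbits indexed by `ℕ`, with marked bounces: `p i` is the momentum of norm `e`
that leaves `q i` at the time `τ i`, and the momentum changes only at the indices in `B`. -/
structure IsOrbit {n : ℕ} (N N' : Seminorm ℝ (Space n)) (B : ℕ → Prop) (q p : ℕ → Space n)
    (τ : ℕ → ℝ) (m : ℕ) (T e : ℝ) : Prop where
  strictMono : StrictMono τ
  period_pos : 0 < m
  periodic_q : ∀ i, q (i + m) = q i
  periodic_p : ∀ i, p (i + m) = p i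
  periodic_τ : ∀ i, τ (i + m) = τ i + T
  periodic_B : ∀ i, B (i + m) ↔ B i
  energy : ∀ i, N' (p i) = e
  move : ∀ i, ∃ v, IsNormal N' N (p i) v ∧ q (i + 1) - q i = (τ (i + 1) - τ i) • v
  kick : ∀ i, B (i + 1) → N (q (i + 1)) = 1 ∧ ∃ ν, IsNormal N N' (q (i + 1)) ν ∧
    ∃ c : ℝ, 0 < c ∧ p (i + 1) - p i = -(c • ν)
  free : ∀ i, ¬ B (i + 1) → p (i + 1) = p i

/-- Orbits whose indices are all bounces are antisymmetric under the shift by the dimension, which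
takes the time `2`, and their period is a multiple of twice the dimension. -/
def BounceRigid {n : ℕ} (N N' : Seminorm ℝ (Space n)) : Prop :=
  ∀ (q p : ℕ → Space n) (τ : ℕ → ℝ) (m : ℕ) (T : ℝ),
    IsOrbit N N' (fun _ => True) q p τ m T 1 →
    (∀ i, q (i + n) = -q i ∧ p (i + n) = -p i ∧ τ (i + n) = τ i + 2) ∧ 2 * n ∣ m

open Classical in
/-- The counterpart of `BounceRigid` for orbits with marked bounces, in terms of time. -/
def TimeRigid {n : ℕ} (N N' : Seminorm ℝ (Space n)) : Prop :=
  ∀ (B : ℕ → Prop) (q p : ℕ → Space n) (τ : ℕ → ℝ) (m : ℕ) (T e : ℝ),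
    IsOrbit N N' B q p τ m T e →
    (∀ i, B i → ∃ j, B j ∧ τ j = τ i + 2) ∧
    (∀ i j, τ j = τ i + 2 → q j = -q i ∧ p j = -p i ∧
      Nat.count B (j + 1) = Nat.count B (i + 1) + n) ∧
    ∃ r : ℕ, T = 4 * r

theorem add_mul_of_add {τ : ℕ → ℝ} {k : ℕ} {c : ℝ} (h : ∀ i, τ (i + k) = τ i + c) (r i : ℕ) :
    τ (i + k * r) = τ i + c * r := by
  induction r with
  | zero => simp
  | succ r ih => rw [Nat.mul_succ, ← add_assoc, h, ih]; push_cast; ring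

/-- With all indices marked, `Nat.count B a = a`, so a delay of `2` is an index shift by `n`. Then
the indices `m` and `2 * n * r` carry the same time, and `τ` is injective. -/
theorem TimeRigid.bounceRigid {n : ℕ} {N N' : Seminorm ℝ (Space n)} (hG : TimeRigid N N') :
    BounceRigid N N' := by
  classical
  intro q p τ m T ho
  obtain ⟨ha, hb, r, hr⟩ := hG _ q p τ m T 1 ho
  have key : ∀ i, q (i + n) = -q i ∧ p (i + n) = -p i ∧ τ (i + n) = τ i + 2 := fun i => by
    obtain ⟨j, -, hj⟩ := ha i trivial
    obtain ⟨h1, h2, h3⟩ := hb i j hj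
    have hc : ∀ (B : ℕ → Prop) (_ : DecidablePred B), (∀ a, B a) → ∀ a, Nat.count B a = a :=
      fun B _ hB a => Nat.count_iff_forall.2 fun b _ => hB b
    rw [hc _ _ fun _ => trivial, hc _ _ fun _ => trivial] at h3
    obtain rfl : j = i + n := by omega
    exact ⟨h1, h2, hj⟩
  refine ⟨key, r, ho.strictMono.injective ?_⟩
  have h1 := add_mul_of_add (τ := τ) (k := 2 * n) (c := 4) (fun i => by
    rw [two_mul, ← add_assoc, (key _).2.2, (key _).2.2]; ring) r 0
  have h2 := ho.periodic_τ 0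
  rw [zero_add] at h1 h2
  rw [h1, h2, hr]

theorem IsOrbit.segment {n : ℕ} {N N' : Seminorm ℝ (Space n)} {B : ℕ → Prop} {q p : ℕ → Space n}
    {τ : ℕ → ℝ} {m : ℕ} {T e : ℝ} (ho : IsOrbit N N' B q p τ m T e) {i : ℕ} {v : Space n}
    (hv : IsNormal N' N (p i) v) (d : ℕ) (hB : ∀ j, i < j → j < i + d → ¬ B j) :
    q (i + d) = q i + (τ (i + d) - τ i) • v ∧ (¬ B (i + d) → p (i + d) = p i) := by
  induction d with
  | zero => simp
  | succ d ih =>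
    obtain ⟨h1, h2⟩ := ih fun j hj hj' => hB j hj (by omega)
    have hp : p (i + d) = p i := by
      rcases Nat.eq_zero_or_pos d with rfl | hd
      · rfl
      · exact h2 (hB _ (by omega) (by omega))
    refine ⟨?_, fun h => (ho.free _ h).trans hp⟩
    obtain ⟨w, hw, hw'⟩ := ho.move (i + d)
    rw [hp] at hw
    rw [hv.eq hw, sub_eq_iff_eq_add, h1] at hw'
    rw [← add_assoc, hw']
    module

/-- Without bounces the motion is along a line with nonzero velocity and cannot close up;
periodicity then repeats any bounce forever. -/
theorem IsOrbit.infinite {n : ℕ} {N N' : Seminorm ℝ (Space n)} (hd : IsDualPair N N')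
    {B : ℕ → Prop} {q p : ℕ → Space n}
    {τ : ℕ → ℝ} {m : ℕ} {T e : ℝ} (ho : IsOrbit N N' B q p τ m T e) :
    (Set.ofPred B).Infinite := by
  have hex : ∃ i, B i := by
    by_contra! hno
    obtain ⟨v, hv, -⟩ := ho.move 0
    have h1 := (ho.segment hv m fun j _ _ => hno j).1
    rw [ho.periodic_q, left_eq_add, smul_eq_zero, sub_eq_zero] at h1
    rcases h1 with h1 | h1
    · exact (Nat.add_pos_right 0 ho.period_pos).ne' (ho.strictMono.injective h1)
    · exact hv.ne_zero hd.symm h1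
  obtain ⟨i, hi⟩ := hex
  have hm := ho.period_pos
  refine Set.infinite_of_not_bddAbove fun ⟨b, hb⟩ => ?_
  have h2 : ∀ r, B (i + m * r) := fun r => by
    induction r with
    | zero => exact hi
    | succ r ih => rw [Nat.mul_succ, ← add_assoc, ho.periodic_B]; exact ih
  have h3 : i + m * (b + 1) ≤ b := hb (h2 (b + 1))
  nlinarith

/-- Discard the unmarked indices and divide the momenta by `e`, which does not change the normals.
The points discarded lie on segments between consecutive bounces, and inherit the antisymmetry by
interpolation in time. -/
theorem BounceRigid.timeRigid {n : ℕ} {N N' : Seminorm ℝ (Space n)} (hd : IsDualPair N N')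
    (hS : BounceRigid N N') : TimeRigid N N' := by
  classical
  intro B q p τ m T e ho
  have hinf := ho.infinite hd
  set E : ℕ → ℕ := Nat.nth B with hE
  set M := Nat.count B m with hM
  have hcE : ∀ j, Nat.count B (E j) = j := Nat.count_nth_of_infinite hinf
  have hBE : ∀ j, B (E j) := Nat.nth_mem_of_infinite hinf
  have hEmono : StrictMono E := Nat.nth_strictMono hinf
  have hcount : ∀ a, Nat.count B (a + m) = Nat.count B a + M := fun a => by
    rw [add_comm, Nat.count_add]
    simp only [add_comm m, ho.periodic_B]
    rw [add_comm]
  have hEper : ∀ j, E (j + M) = E j + m := fun j => by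
    have h1 := Nat.nth_count (p := B) ((ho.periodic_B _).2 (hBE j))
    rwa [hcount, hcE] at h1
  have hMpos : 0 < M := by
    rcases Nat.eq_zero_or_pos M with h | h
    · have h1 := hEper 0
      have h2 := ho.period_pos
      rw [h, add_zero] at h1
      omega
    · exact h
  have he : 0 < e := by
    obtain ⟨v, hv, -⟩ := ho.move 0
    exact ho.energy 0 ▸ hv.pos hd.symm
  have hbetween : ∀ j i, E j < i → i < E (j + 1) → ¬ B i := fun j i h1 h2 hi => by
    rw [← Nat.nth_count hi] at h1 h2
    have h3 := hEmono.lt_iff_lt.1 h1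
    have h4 := hEmono.lt_iff_lt.1 h2
    omega
  have hseg : ∀ j i v, IsNormal N' N (p (E j)) v → E j ≤ i → i ≤ E (j + 1) →
      q i = q (E j) + (τ i - τ (E j)) • v ∧ (i < E (j + 1) → p i = p (E j)) := by
    intro j i v hv h1 h2
    obtain ⟨d, rfl⟩ := Nat.exists_eq_add_of_le h1
    obtain ⟨h3, h4⟩ := ho.segment hv d fun a ha ha' => hbetween j a ha (by omega)
    refine ⟨h3, fun h5 => ?_⟩
    rcases Nat.eq_zero_or_pos d with rfl | hd
    · rfl
    · exact h4 (hbetween j _ (by omega) h5)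
  have horb : IsOrbit N N' (fun _ => True) (fun j => q (E j)) (fun j => e⁻¹ • p (E j))
      (fun j => τ (E j)) M T 1 := by
    refine ⟨fun a b hab => ho.strictMono (hEmono hab), hMpos, fun j => ?_, fun j => ?_, fun j => ?_,
      fun _ => Iff.rfl, fun j => ?_, fun j => ?_, fun j _ => ?_, fun j h => (h trivial).elim⟩
    · simp only [hEper, ho.periodic_q]
    · simp only [hEper, ho.periodic_p]
    · simp only [hEper, ho.periodic_τ]
    · rw [map_smul_eq_mul, Real.norm_of_nonneg (inv_nonneg.2 he.le), ho.energy,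
        inv_mul_cancel₀ he.ne']
    · obtain ⟨v, hv, -⟩ := ho.move (E j)
      refine ⟨v, hv.smul (inv_pos.2 he), ?_⟩
      rw [(hseg j _ v hv (hEmono (Nat.lt_succ_self j)).le le_rfl).1]
      abel
    · have hlt := hEmono (Nat.lt_succ_self j)
      obtain ⟨a, ha⟩ := Nat.exists_eq_add_of_lt hlt
      simp only [Nat.succ_eq_add_one] at ha
      have hB := hBE (j + 1)
      obtain ⟨v, hv, -⟩ := ho.move (E j)
      have hp := (hseg j (E j + a) v hv (by omega) (by omega)).2 (by omega)
      rw [ha] at hB ⊢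
      obtain ⟨h1, ν, h2, c, hc, h3⟩ := ho.kick _ hB
      refine ⟨h1, ν, h2, e⁻¹ * c, mul_pos (inv_pos.2 he) hc, ?_⟩
      rw [← smul_sub, ← hp, h3, smul_neg, smul_smul]
  obtain ⟨hS1, r, hS2⟩ := hS _ _ _ _ _ horb
  have hqE : ∀ j, q (E (j + n)) = -q (E j) := fun j => (hS1 j).1
  have hpE : ∀ j, p (E (j + n)) = -p (E j) := fun j => by
    have h1 := (hS1 j).2.1
    rw [← smul_neg] at h1
    exact smul_right_injective _ (inv_ne_zero he.ne') h1
  have hτE : ∀ j, τ (E (j + n)) = τ (E j) + 2 := fun j => (hS1 j).2.2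
  refine ⟨fun i hi => ?_, ?_, r, ?_⟩
  · refine ⟨E (Nat.count B i + n), hBE _, ?_⟩
    rw [hτE, hE, Nat.nth_count hi]
  · have main : ∀ i j c, E c ≤ i → i < E (c + 1) → τ j = τ i + 2 → q j = -q i ∧ p j = -p i ∧
        Nat.count B (j + 1) = Nat.count B (i + 1) + n := by
      intro i j c h1 h2 hij
      have h3 : E (c + n) ≤ j := by
        rw [← ho.strictMono.le_iff_le, hτE, hij]
        have := ho.strictMono.monotone h1
        linarith
      have h4 : j < E (c + n + 1) := by
        rw [← ho.strictMono.lt_iff_lt, add_right_comm, hτE, hij]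
        have := ho.strictMono h2
        linarith
      have hcnt : ∀ a b, E a ≤ b → b < E (a + 1) → Nat.count B (b + 1) = a + 1 := by
        intro a b hab hba
        refine le_antisymm ?_ ?_
        · rw [Nat.count_le_iff_le_nth hinf]
          exact hba
        · rw [← Nat.count_nth_succ_of_infinite hinf a]
          exact Nat.count_monotone B (Nat.succ_le_succ hab)
      obtain ⟨v, hv, -⟩ := ho.move (E c)
      obtain ⟨h5, h6⟩ := hseg c i v hv h1 h2.le
      obtain ⟨h7, h8⟩ := hseg (c + n) j (-v) (by rw [hpE]; exact hv.neg) h3 h4.le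
      refine ⟨?_, ?_, ?_⟩
      · rw [h7, h5, hij, hqE, hτE]
        module
      · rw [h8 h4, h6 h2, hpE]
      · rw [hcnt c i h1 h2, hcnt (c + n) j h3 h4]
        ring
    intro i j hij
    -- The index `i` may precede the first bounce `E 0`; one period later there is a bounce before
    -- it.
    have hloc : ∃ c, E c ≤ i + m ∧ i + m < E (c + 1) := by
      have h1 : 0 < Nat.count B (i + m + 1) := by
        have := Nat.count_monotone B (show m ≤ i + m + 1 by omega)
        omega
      obtain ⟨c, hc⟩ := Nat.exists_eq_add_of_lt h1
      rw [zero_add] at hc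
      exact ⟨c, Nat.lt_succ_iff.1 (Nat.nth_lt_of_lt_count (hc ▸ Nat.lt_succ_self c)),
        (Nat.count_le_iff_le_nth hinf).1 hc.le⟩
    obtain ⟨c, hc1, hc2⟩ := hloc
    have h := main (i + m) (j + m) c hc1 hc2 (by rw [ho.periodic_τ, ho.periodic_τ, hij]; ring)
    rw [ho.periodic_q, ho.periodic_q, ho.periodic_p, ho.periodic_p, add_right_comm, hcount,
      add_right_comm i, hcount] at h
    exact ⟨h.1, h.2.1, by omega⟩
  · have h1 := add_mul_of_add (τ := fun j => τ (E j)) (k := 2 * n) (c := 4) (fun i => by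
      rw [two_mul, ← add_assoc, hτE, hτE]; ring) r 0
    have h2 := ho.periodic_τ (E 0)
    rw [← hS2] at h1
    simp only [hEper, h2] at h1
    linarith

/-! ### Exchange of coordinates and momenta. -/

theorem BounceRigid.symm {n : ℕ} {N N' : Seminorm ℝ (Space n)} (hd : IsDualPair N N')
    (hS : BounceRigid N N') : BounceRigid N' N := by
  intro q p τ m T ho
  set σ : ℕ → ℝ := fun i => ∑ j ∈ Finset.range i, N (p (j + 1) - p j) with hσ
  have hσs : ∀ i, σ (i + 1) - σ i = N (p (i + 1) - p i) := fun i => by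
    simp [hσ, Finset.sum_range_succ]
  have hstep : ∀ i, ∃ ν, IsNormal N' N (q (i + 1)) ν ∧ 0 < σ (i + 1) - σ i ∧
      p (i + 1) - p i = -((σ (i + 1) - σ i) • ν) := fun i => by
    obtain ⟨-, ν, hν, c, hc, h⟩ := ho.kick i trivial
    have h1 : σ (i + 1) - σ i = c := by
      rw [hσs, h, map_neg_eq_map, map_smul_eq_mul, Real.norm_of_nonneg hc.le, hν.eq_one hd.symm,
        mul_one]
    exact ⟨ν, hν, h1 ▸ hc, h1 ▸ h⟩
  have hq1 : ∀ i, N' (q (i + 1)) = 1 := fun i => (ho.kick i trivial).1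
  have horb : IsOrbit N N' (fun _ => True) p (fun i => -q (i + 1)) σ m (σ m) 1 := by
    refine ⟨strictMono_nat_of_lt_succ fun i => ?_, ho.period_pos, ho.periodic_p, fun i => ?_,
      fun i => ?_, fun _ => Iff.rfl, fun i => ?_, fun i => ?_, fun i _ => ⟨ho.energy _, ?_⟩,
      fun i h => (h trivial).elim⟩
    · obtain ⟨-, -, h, -⟩ := hstep i
      linarith
    · rw [add_right_comm, ho.periodic_q]
    · rw [add_comm i, hσ]
      simp only [Finset.sum_range_add]
      rw [add_comm]
      congr 1
      refine Finset.sum_congr rfl fun j _ => ?_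
      rw [add_comm m, add_right_comm, ho.periodic_p, ho.periodic_p]
    · rw [map_neg_eq_map, hq1]
    · obtain ⟨ν, h1, -, h2⟩ := hstep i
      exact ⟨-ν, h1.neg, by rw [h2, smul_neg]⟩
    · obtain ⟨v, hv, h⟩ := ho.move (i + 1)
      refine ⟨v, hv, τ (i + 1 + 1) - τ (i + 1), sub_pos.2 (ho.strictMono (Nat.lt_succ_self _)), ?_⟩
      rw [← h]
      abel
  obtain ⟨h1, h2⟩ := hS _ _ _ _ _ horb
  have hp : ∀ i, p (i + n) = -p i := fun i => (h1 i).1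
  -- The dual momentum at `i` is `-q (i + 1)`, so index `0` is reached only through a period.
  have hq : ∀ i, q (i + n) = -q i := fun i => by
    obtain ⟨a, ha⟩ := Nat.exists_eq_add_of_lt ho.period_pos
    have h3 := (h1 (i + a)).2.1
    rw [neg_inj, show i + a + n + 1 = i + n + m by omega, show i + a + 1 = i + m by omega,
      ho.periodic_q, ho.periodic_q] at h3
    exact h3
  -- A discrete product rule: `⟨p, q⟩` grows by the increment of `τ` when `q` moves and drops by
  -- that of `σ` when `p` jumps, as both have norm `1`.
  have hconst : ∀ i, τ i - σ i - inner ℝ (p i) (q i) = τ 0 - σ 0 - inner ℝ (p 0) (q 0) := by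
    intro i
    induction i with
    | zero => rfl
    | succ i ih =>
      rw [← ih]
      obtain ⟨v, hv, h3⟩ := ho.move i
      obtain ⟨ν, hν, -, h4⟩ := hstep i
      have h5 : inner ℝ (p i) (q (i + 1) - q i) = τ (i + 1) - τ i := by
        rw [h3, inner_smul_right, real_inner_comm, hv.inner_eq, ho.energy, mul_one]
      have h6 : inner ℝ (p (i + 1) - p i) (q (i + 1)) = -(σ (i + 1) - σ i) := by
        rw [h4, inner_neg_left, inner_smul_left, hν.inner_eq, hq1, mul_one]
        simp
      rw [inner_sub_right] at h5
      rw [inner_sub_left] at h6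
      linarith
  refine ⟨fun i => ⟨hq i, hp i, ?_⟩, h2⟩
  have h3 := hconst (i + n)
  rw [← hconst i, hp, hq, inner_neg_neg] at h3
  have h4 := (h1 i).2.2
  linarith

/-! ### Sums of norms and the splitting of normals. -/

section Parts

variable {k l : ℕ}

/-- `firstPart` as a linear map. -/
def firstMap (k l : ℕ) : Space (k + l) →ₗ[ℝ] Space k where
  toFun := firstPart
  map_add' _ _ := rfl
  map_smul' _ _ := rfl

/-- `lastPart` as a linear map. -/
def lastMap (k l : ℕ) : Space (k + l) →ₗ[ℝ] Space l where
  toFun := lastPart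
  map_add' _ _ := rfl
  map_smul' _ _ := rfl

theorem firstMap_apply (x : Space (k + l)) : firstMap k l x = firstPart x := rfl

theorem lastMap_apply (x : Space (k + l)) : lastMap k l x = lastPart x := rfl

/-- The vector of `ℝᵏ⁺ˡ` with the given first and last parts. -/
def joinParts (x : Space k) (y : Space l) : Space (k + l) :=
  WithLp.toLp 2 (Fin.append x y)

@[simp] theorem firstMap_joinParts (x : Space k) (y : Space l) :
    firstMap k l (joinParts x y) = x := by
  ext i; simp [firstMap_apply, firstPart, joinParts]

@[simp] theorem lastMap_joinParts (x : Space k) (y : Space l) :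
    lastMap k l (joinParts x y) = y := by
  ext i; simp [lastMap_apply, lastPart, joinParts]

theorem ext_parts {x y : Space (k + l)} (h1 : firstMap k l x = firstMap k l y)
    (h2 : lastMap k l x = lastMap k l y) : x = y := by
  ext i
  refine Fin.addCases (fun j => ?_) (fun j => ?_) i
  · exact congrArg (fun z : Space k => z j) h1
  · exact congrArg (fun z : Space l => z j) h2

theorem inner_parts (x y : Space (k + l)) : inner ℝ x y =
    inner ℝ (firstMap k l x) (firstMap k l y) + inner ℝ (lastMap k l x) (lastMap k l y) := by
  simp [PiLp.inner_apply, Fin.sum_univ_add, firstMap_apply, lastMap_apply, firstPart, lastPart]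

/-- The `ℓ₁`-sum of two seminorms. -/
def sumSeminorm (N : Seminorm ℝ (Space k)) (M : Seminorm ℝ (Space l)) :
    Seminorm ℝ (Space (k + l)) :=
  N.comp (firstMap k l) + M.comp (lastMap k l)

/-- The `ℓ_∞`-sum of two seminorms. -/
def maxSeminorm (N : Seminorm ℝ (Space k)) (M : Seminorm ℝ (Space l)) :
    Seminorm ℝ (Space (k + l)) :=
  N.comp (firstMap k l) ⊔ M.comp (lastMap k l)

theorem sumSeminorm_apply (N : Seminorm ℝ (Space k)) (M : Seminorm ℝ (Space l))
    (x : Space (k + l)) :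
    sumSeminorm N M x = N (firstMap k l x) + M (lastMap k l x) := rfl

theorem maxSeminorm_apply (N : Seminorm ℝ (Space k)) (M : Seminorm ℝ (Space l))
    (x : Space (k + l)) :
    maxSeminorm N M x = max (N (firstMap k l x)) (M (lastMap k l x)) := rfl

end Parts

variable {k l : ℕ} {N N' : Seminorm ℝ (Space k)} {M M' : Seminorm ℝ (Space l)}

theorem IsDualPair.inner_le_of_le {n : ℕ} {N N' : Seminorm ℝ (Space n)} (h : IsDualPair N N')
    {p : Space n} (hp : N' p ≤ 1) (q : Space n) : inner ℝ p q ≤ N q :=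
  (h.inner_le p q).trans (mul_le_of_le_one_left (apply_nonneg N q) hp)

theorem IsDualPair.max (hN : IsDualPair N N') (hM : IsDualPair M M') :
    IsDualPair (maxSeminorm N M) (sumSeminorm N' M') where
  pos := Nat.add_pos_left hN.pos l
  cont := (hN.cont.comp (firstMap k l).continuous_of_finiteDimensional).sup
    (hM.cont.comp (lastMap k l).continuous_of_finiteDimensional)
  cont' := (hN.cont'.comp (firstMap k l).continuous_of_finiteDimensional).add
    (hM.cont'.comp (lastMap k l).continuous_of_finiteDimensional)
  inner_le p q := by
    rw [inner_parts, sumSeminorm_apply, maxSeminorm_apply, add_mul]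
    refine add_le_add ((hN.inner_le _ _).trans ?_) ((hM.inner_le _ _).trans ?_)
    · exact mul_le_mul_of_nonneg_left (le_max_left _ _) (apply_nonneg _ _)
    · exact mul_le_mul_of_nonneg_left (le_max_right _ _) (apply_nonneg _ _)
  attained q := by
    rcases le_total (M (lastMap k l q)) (N (firstMap k l q)) with h | h
    · obtain ⟨p, hp, hpq⟩ := hN.attained (firstMap k l q)
      refine ⟨joinParts p 0, ?_, ?_⟩
      · simpa [sumSeminorm_apply] using hp
      · simp [inner_parts, maxSeminorm_apply, hpq, h]
    · obtain ⟨p, hp, hpq⟩ := hM.attained (lastMap k l q)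
      refine ⟨joinParts 0 p, ?_, ?_⟩
      · simpa [sumSeminorm_apply] using hp
      · simp [inner_parts, maxSeminorm_apply, hpq, h]
  attained' p := by
    obtain ⟨x, hx, hx'⟩ := hN.attained' (firstMap k l p)
    obtain ⟨y, hy, hy'⟩ := hM.attained' (lastMap k l p)
    refine ⟨joinParts x y, ?_, ?_⟩
    · simp [maxSeminorm_apply, hx, hy]
    · simp [inner_parts, sumSeminorm_apply, hx', hy']

/-- The unit ball of the maximum is a product, so the two parts of the norming vector are optimal,
and unique, independently. -/
theorem IsNormal.parts_of_sum (hN : IsDualPair N N') (hM : IsDualPair M M') {p v : Space (k + l)}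
    (h : IsNormal (sumSeminorm N' M') (maxSeminorm N M) p v) :
    IsNormal N' N (firstMap k l p) (firstMap k l v) ∧
      IsNormal M' M (lastMap k l p) (lastMap k l v) := by
  obtain ⟨h1, h2, h3⟩ := h
  rw [maxSeminorm_apply, max_le_iff] at h1
  rw [sumSeminorm_apply, inner_parts] at h2
  have h4 := hN.symm.inner_le_of_le h1.1 (firstMap k l p)
  have h5 := hM.symm.inner_le_of_le h1.2 (lastMap k l p)
  refine ⟨⟨h1.1, by linarith, fun g hg hgp => ?_⟩, ⟨h1.2, by linarith, fun g hg hgp => ?_⟩⟩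
  · rw [← h3 (joinParts g (lastMap k l v)), firstMap_joinParts]
    · simp [maxSeminorm_apply, hg, h1.2]
    · simp only [inner_parts, sumSeminorm_apply, firstMap_joinParts, lastMap_joinParts]
      linarith
  · rw [← h3 (joinParts (firstMap k l v) g), lastMap_joinParts]
    · simp [maxSeminorm_apply, hg, h1.1]
    · simp only [inner_parts, sumSeminorm_apply, firstMap_joinParts, lastMap_joinParts]
      linarith

/-- A norming functional of a part of norm `1`, extended by zero, norms `q` and hence is `ν`. If
both parts had norm `1`, this would give `ν` with a last part both zero and nonzero. -/
theorem IsNormal.parts_of_max (hN : IsDualPair N N') (hM : IsDualPair M M') {q ν : Space (k + l)}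
    (h : IsNormal (maxSeminorm N M) (sumSeminorm N' M') q ν) (hq : maxSeminorm N M q = 1) :
    (N (firstMap k l q) = 1 ∧ M (lastMap k l q) ≠ 1 ∧
      IsNormal N N' (firstMap k l q) (firstMap k l ν) ∧ lastMap k l ν = 0) ∨
    (M (lastMap k l q) = 1 ∧ N (firstMap k l q) ≠ 1 ∧
      IsNormal M M' (lastMap k l q) (lastMap k l ν) ∧ firstMap k l ν = 0) := by
  have hL : ∀ g, N (firstMap k l q) = 1 → N' g ≤ 1 → inner ℝ g (firstMap k l q) = 1 →
      joinParts g 0 = ν := fun g _ hg hgq =>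
    h.unique _ (by simpa [sumSeminorm_apply] using hg) (by simp [inner_parts, hgq, hq])
  have hR : ∀ g, M (lastMap k l q) = 1 → M' g ≤ 1 → inner ℝ g (lastMap k l q) = 1 →
      joinParts 0 g = ν := fun g _ hg hgq =>
    h.unique _ (by simpa [sumSeminorm_apply] using hg) (by simp [inner_parts, hgq, hq])
  have hL' : N (firstMap k l q) = 1 →
      IsNormal N N' (firstMap k l q) (firstMap k l ν) ∧ lastMap k l ν = 0 := fun h1 => by
    obtain ⟨g, hg, hgq⟩ := hN.attained (firstMap k l q)
    rw [h1] at hgq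
    rw [← hL g h1 hg hgq, firstMap_joinParts, lastMap_joinParts]
    refine ⟨⟨hg, hgq.trans h1.symm, fun g' hg' hgq' => ?_⟩, rfl⟩
    have h2 := (hL g' h1 hg' (hgq'.trans h1)).trans (hL g h1 hg hgq).symm
    simpa using congrArg (firstMap k l) h2
  have hR' : M (lastMap k l q) = 1 →
      IsNormal M M' (lastMap k l q) (lastMap k l ν) ∧ firstMap k l ν = 0 := fun h1 => by
    obtain ⟨g, hg, hgq⟩ := hM.attained (lastMap k l q)
    rw [h1] at hgq
    rw [← hR g h1 hg hgq, firstMap_joinParts, lastMap_joinParts]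
    refine ⟨⟨hg, hgq.trans h1.symm, fun g' hg' hgq' => ?_⟩, rfl⟩
    have h2 := (hR g' h1 hg' (hgq'.trans h1)).trans (hR g h1 hg hgq).symm
    simpa using congrArg (lastMap k l) h2
  rw [maxSeminorm_apply] at hq
  by_cases h1 : N (firstMap k l q) = 1
  · obtain ⟨h2, h3⟩ := hL' h1
    exact Or.inl ⟨h1, fun h4 => (hR' h4).1.ne_zero hM h3, h2, h3⟩
  · have h2 : M (lastMap k l q) = 1 := by
      rcases max_choice (N (firstMap k l q)) (M (lastMap k l q)) with h3 | h3
      · exact absurd (h3.symm.trans hq) h1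
      · exact h3.symm.trans hq
    exact Or.inr ⟨h2, h1, hR' h2⟩

/-! ### Projecting an orbit to a factor; rigidity of sums. -/

/-- The change of the data at a bounce off a facet of the first summand. -/
def IsPartialKick (N N' : Seminorm ℝ (Space k)) (M : Seminorm ℝ (Space l)) (x a a' : Space k)
    (y b b' : Space l) : Prop :=
  N x = 1 ∧ M y ≠ 1 ∧ (∃ ν, IsNormal N N' x ν ∧ ∃ c : ℝ, 0 < c ∧ a' - a = -(c • ν)) ∧ b' = b

theorem IsOrbit.kick_parts (hN : IsDualPair N N') (hM : IsDualPair M M') {B : ℕ → Prop}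
    {q p : ℕ → Space (k + l)} {τ : ℕ → ℝ} {m : ℕ} {T e : ℝ}
    (ho : IsOrbit (maxSeminorm N M) (sumSeminorm N' M') B q p τ m T e) (i : ℕ) (hi : B (i + 1)) :
    IsPartialKick N N' M (firstMap k l (q (i + 1))) (firstMap k l (p i)) (firstMap k l (p (i + 1)))
      (lastMap k l (q (i + 1))) (lastMap k l (p i)) (lastMap k l (p (i + 1))) ∨
    IsPartialKick M M' N (lastMap k l (q (i + 1))) (lastMap k l (p i)) (lastMap k l (p (i + 1)))
      (firstMap k l (q (i + 1))) (firstMap k l (p i)) (firstMap k l (p (i + 1))) := by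
  obtain ⟨h1, ν, hν, c, hc, h2⟩ := ho.kick i hi
  have h3 := congrArg (firstMap k l) h2
  have h4 := congrArg (lastMap k l) h2
  simp only [map_sub, map_neg, map_smul] at h3 h4
  rcases hν.parts_of_max hN hM h1 with ⟨h5, h6, h7, h8⟩ | ⟨h5, h6, h7, h8⟩
  · rw [h8, smul_zero, neg_zero, sub_eq_zero] at h4
    exact Or.inl ⟨h5, h6, ⟨_, h7, c, hc, h3⟩, h4⟩
  · rw [h8, smul_zero, neg_zero, sub_eq_zero] at h3
    exact Or.inr ⟨h5, h6, ⟨_, h7, c, hc, h4⟩, h3⟩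

/-- Only bounces off this factor stay marked. The energy `N' (a i)` is constant: `a` changes only
when `b` does not, and the total `e` is fixed. -/
theorem isOrbit_of_partialKick {B : ℕ → Prop} {x a : ℕ → Space k} {y b : ℕ → Space l}
    {τ : ℕ → ℝ} {m : ℕ} {T e : ℝ} (hτ : StrictMono τ) (hm : 0 < m) (hx : ∀ i, x (i + m) = x i)
    (ha : ∀ i, a (i + m) = a i) (hτm : ∀ i, τ (i + m) = τ i + T) (hB : ∀ i, B (i + m) ↔ B i)
    (he : ∀ i, N' (a i) + M' (b i) = e)
    (hmove : ∀ i, ∃ v, IsNormal N' N (a i) v ∧ x (i + 1) - x i = (τ (i + 1) - τ i) • v)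
    (hkick : ∀ i, B (i + 1) →
      IsPartialKick N N' M (x (i + 1)) (a i) (a (i + 1)) (y (i + 1)) (b i) (b (i + 1)) ∨
      IsPartialKick M M' N (y (i + 1)) (b i) (b (i + 1)) (x (i + 1)) (a i) (a (i + 1)))
    (hfree : ∀ i, ¬ B (i + 1) → a (i + 1) = a i) :
    IsOrbit N N' (fun i => B i ∧ N (x i) = 1) x a τ m T (N' (a 0)) where
  strictMono := hτ
  period_pos := hm
  periodic_q := hx
  periodic_p := ha
  periodic_τ := hτm
  periodic_B i := by rw [hB, hx]
  energy i := by
    induction i with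
    | zero => rfl
    | succ i ih =>
      rw [← ih]
      by_cases hi : B (i + 1)
      · rcases hkick i hi with h | h
        · have h1 := he i
          have h2 := he (i + 1)
          rw [h.2.2.2] at h2
          linarith
        · rw [h.2.2.2]
      · rw [hfree i hi]
  move := hmove
  kick i hi := by
    rcases hkick i hi.1 with h | h
    · exact ⟨h.1, h.2.2.1⟩
    · exact absurd hi.2 h.2.1
  free i hi := by
    by_cases hi' : B (i + 1)
    · rcases hkick i hi' with h | h
      · exact absurd ⟨hi', h.1⟩ hi
      · exact h.2.2.2
    · exact hfree i hi'

theorem count_add_count {B P Q : ℕ → Prop} [DecidablePred B] [DecidablePred P] [DecidablePred Q]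
    (h1 : ∀ i, B i ↔ P i ∨ Q i) (h2 : ∀ i, ¬ (P i ∧ Q i)) (a : ℕ) :
    Nat.count B a = Nat.count P a + Nat.count Q a := by
  induction a with
  | zero => simp
  | succ a ih =>
    have h3 := h1 a
    have h4 := h2 a
    rw [Nat.count_succ, Nat.count_succ, Nat.count_succ, ih]
    by_cases hP : P a <;> by_cases hQ : Q a <;> simp_all <;> omega

theorem TimeRigid.max (hN : IsDualPair N N') (hM : IsDualPair M M') (hGN : TimeRigid N N')
    (hGM : TimeRigid M M') : TimeRigid (maxSeminorm N M) (sumSeminorm N' M') := by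
  classical
  intro B q p τ m T e ho
  have hkick := ho.kick_parts hN hM
  obtain ⟨a1, b1, c1⟩ := hGN _ _ _ _ _ _ _ (isOrbit_of_partialKick (M' := M') (e := e) (B := B)
    (x := fun i => firstMap k l (q i)) (a := fun i => firstMap k l (p i))
    (y := fun i => lastMap k l (q i)) (b := fun i => lastMap k l (p i))
    ho.strictMono ho.period_pos
    (fun i => congrArg _ (ho.periodic_q i)) (fun i => congrArg _ (ho.periodic_p i)) ho.periodic_τ
    ho.periodic_B ho.energy
    (fun i => by
      obtain ⟨v, hv, h⟩ := ho.move i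
      refine ⟨_, (hv.parts_of_sum hN hM).1, ?_⟩
      rw [← map_sub, h, map_smul])
    hkick (fun i hi => congrArg _ (ho.free i hi)))
  obtain ⟨a2, b2, -⟩ := hGM _ _ _ _ _ _ _ (isOrbit_of_partialKick (M' := N') (e := e) (B := B)
    (x := fun i => lastMap k l (q i)) (a := fun i => lastMap k l (p i))
    (y := fun i => firstMap k l (q i)) (b := fun i => firstMap k l (p i))
    ho.strictMono ho.period_pos
    (fun i => congrArg _ (ho.periodic_q i)) (fun i => congrArg _ (ho.periodic_p i)) ho.periodic_τ
    ho.periodic_B (fun i => (add_comm _ _).trans (ho.energy i))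
    (fun i => by
      obtain ⟨v, hv, h⟩ := ho.move i
      refine ⟨_, (hv.parts_of_sum hN hM).2, ?_⟩
      rw [← map_sub, h, map_smul])
    (fun i hi => (hkick i hi).symm) (fun i hi => congrArg _ (ho.free i hi)))
  have hsplit : ∀ i, B i → (N (firstMap k l (q i)) = 1 ∧ M (lastMap k l (q i)) ≠ 1) ∨
      (M (lastMap k l (q i)) = 1 ∧ N (firstMap k l (q i)) ≠ 1) := fun i hi => by
    -- Kicks are recorded at successors only, so `i` is replaced by `i + m`.
    obtain ⟨d, hd⟩ := Nat.exists_eq_add_of_lt ho.period_pos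
    have hid : i + m = i + d + 1 := by omega
    have hi' := (ho.periodic_B i).2 hi
    rw [← ho.periodic_q i]
    rw [hid] at hi' ⊢
    exact (hkick _ hi').imp (fun h => ⟨h.1, h.2.1⟩) (fun h => ⟨h.1, h.2.1⟩)
  refine ⟨fun i hi => ?_, fun i j hij => ?_, c1⟩
  · rcases hsplit i hi with h | h
    · obtain ⟨j, hj, hj'⟩ := a1 i ⟨hi, h.1⟩
      exact ⟨j, hj.1, hj'⟩
    · obtain ⟨j, hj, hj'⟩ := a2 i ⟨hi, h.1⟩
      exact ⟨j, hj.1, hj'⟩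
  · obtain ⟨h1, h2, h3⟩ := b1 i j hij
    obtain ⟨h4, h5, h6⟩ := b2 i j hij
    refine ⟨ext_parts (by rw [h1, map_neg]) (by rw [h4, map_neg]),
      ext_parts (by rw [h2, map_neg]) (by rw [h5, map_neg]), ?_⟩
    have hc := @count_add_count B (fun i => B i ∧ N (firstMap k l (q i)) = 1)
      (fun i => B i ∧ M (lastMap k l (q i)) = 1) (fun _ => Classical.propDecidable _)
      (fun _ => Classical.propDecidable _) (fun _ => Classical.propDecidable _)
      (fun i => ⟨fun h => (hsplit i h).imp (fun h' => ⟨h, h'.1⟩) (fun h' => ⟨h, h'.1⟩),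
        fun h => h.elim And.left And.left⟩)
      (fun i h => (hsplit i h.1.1).elim (fun h' => h'.2 h.2.2) (fun h' => h'.2 h.1.2))
    rw [hc, hc]
    omega

theorem BounceRigid.max (hN : IsDualPair N N') (hM : IsDualPair M M') (hSN : BounceRigid N N')
    (hSM : BounceRigid M M') : BounceRigid (maxSeminorm N M) (sumSeminorm N' M') :=
  ((hSN.timeRigid hN).max hN hM (hSM.timeRigid hM)).bounceRigid

theorem BounceRigid.sum (hN : IsDualPair N N') (hM : IsDualPair M M') (hSN : BounceRigid N N')
    (hSM : BounceRigid M M') : BounceRigid (sumSeminorm N M) (maxSeminorm N' M') :=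
  ((hSN.symm hN).max hN.symm hM.symm (hSM.symm hM)).symm (hN.symm.max hM.symm)

/-! ### The segment. -/

theorem norm_space_one (x : Space 1) : ‖x‖ = |x 0| := by
  rw [EuclideanSpace.norm_eq]
  simp [Real.sqrt_sq_eq_abs]

theorem isDualPair_norm {n : ℕ} (hn : 0 < n) :
    IsDualPair (normSeminorm ℝ (Space n)) (normSeminorm ℝ (Space n)) := by
  have key : ∀ q : Space n, ∃ p : Space n, ‖p‖ ≤ 1 ∧ inner ℝ p q = ‖q‖ := fun q => by
    rcases eq_or_ne q 0 with rfl | hq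
    · exact ⟨0, by simp, by simp⟩
    · have hq' : ‖q‖ ≠ 0 := norm_ne_zero_iff.2 hq
      refine ⟨‖q‖⁻¹ • q, ?_, ?_⟩
      · rw [norm_smul, norm_inv, norm_norm, inv_mul_cancel₀ hq']
      · rw [real_inner_smul_left, real_inner_self_eq_norm_sq]
        field_simp
  exact ⟨hn, continuous_norm, continuous_norm, real_inner_le_norm, key, key⟩

theorem bounceRigid_norm_one :
    BounceRigid (normSeminorm ℝ (Space 1)) (normSeminorm ℝ (Space 1)) := by
  intro q p τ m T ho
  have hext : ∀ x y : Space 1, x 0 = y 0 → x = y := fun x y h => by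
    ext i
    rwa [Subsingleton.elim i 0]
  have hq : ∀ i, q i 0 ^ 2 = 1 := fun i => by
    obtain ⟨d, hd⟩ := Nat.exists_eq_add_of_lt ho.period_pos
    have h1 : ‖q (i + d + 1)‖ = 1 := (ho.kick (i + d) trivial).1
    rw [show i + d + 1 = i + m by omega, ho.periodic_q, norm_space_one] at h1
    rw [← sq_abs, h1, one_pow]
  have hp : ∀ i, p i 0 ^ 2 = 1 := fun i => by
    have h1 : ‖p i‖ = 1 := ho.energy i
    rw [norm_space_one] at h1
    rw [← sq_abs, h1, one_pow]
  have hsq : ∀ {x : ℝ}, x ^ 2 = 1 → x = 1 ∨ x = -1 := fun h => by rwa [sq, mul_self_eq_one_iff] at h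
  have hmain : ∀ i, q i 0 = -p i 0 ∧ q (i + 1) 0 = p i 0 ∧ τ (i + 1) = τ i + 2 := fun i => by
    obtain ⟨v, hv, h1⟩ := ho.move i
    have h2 : p i = v := hv.unique _ (ho.energy i).le
      ((real_inner_self_eq_norm_mul_norm _).trans (by
        have h3 : ‖p i‖ = 1 := ho.energy i
        change ‖p i‖ * ‖p i‖ = ‖p i‖
        rw [h3, one_mul]))
    have h3 := congrArg (fun z : Space 1 => z 0) h1
    simp only [← h2, PiLp.sub_apply, PiLp.smul_apply, smul_eq_mul] at h3
    have h4 := ho.strictMono (Nat.lt_succ_self i)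
    simp only [Nat.succ_eq_add_one] at h4
    -- As time increases, only the two sign patterns crossing the whole segment in the direction of
    -- `p i` survive.
    rcases hsq (hp i) with h5 | h5 <;>
    rcases hsq (hq i) with h6 | h6 <;>
    rcases hsq (hq (i + 1)) with h7 | h7 <;>
    rw [h5, h6, h7] at h3 ⊢ <;> first | (exfalso; linarith) | skip
    all_goals refine ⟨by norm_num, by norm_num, by linarith⟩
  have hneg : ∀ i, q (i + 1) = -q i := fun i => hext _ _ (by
    rw [PiLp.neg_apply, (hmain i).2.1, (hmain i).1, neg_neg])
  refine ⟨fun i => ⟨hneg i, hext _ _ ?_, (hmain i).2.2⟩, ?_⟩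
  · rw [PiLp.neg_apply, ← (hmain i).2.1, (hmain (i + 1)).1, neg_neg]
  · rw [mul_one]
    rcases Nat.even_or_odd' m with ⟨r, rfl | rfl⟩
    · exact dvd_mul_right 2 r
    · exfalso
      have h1 : ∀ s, q (2 * s) = q 0 := fun s => by
        induction s with
        | zero => rfl
        | succ s ih => rw [Nat.mul_succ, hneg (2 * s + 1), hneg, neg_neg, ih]
      have h2 := ho.periodic_q 0
      rw [zero_add, hneg, h1] at h2
      have h3 := congrArg (fun z : Space 1 => z 0) h2
      simp only [PiLp.neg_apply] at h3
      have h4 := hq 0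
      have h5 : q 0 0 = 0 := by linarith
      rw [h5] at h4
      norm_num at h4

/-! ### From bodies and trajectories to norms and orbits. -/

section Bodies

variable {n : ℕ} {N N' : Seminorm ℝ (Space n)}

theorem gauge_unitBody {E : Type*} [AddCommGroup E] [Module ℝ E] (N : Seminorm ℝ E) :
    gauge {x | N x ≤ 1} = N := by
  ext x
  refine le_antisymm (le_of_forall_gt_imp_ge_of_dense fun r hr => ?_) ?_
  · have hr0 : 0 < r := (apply_nonneg N x).trans_lt hr
    refine gauge_le_of_mem hr0.le ?_
    rw [Set.mem_smul_set_iff_inv_smul_mem₀ hr0.ne', Set.mem_ofPred_eq, map_smul_eq_mul,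
      Real.norm_of_nonneg (inv_nonneg.2 hr0.le), inv_mul_le_iff₀ hr0, mul_one]
    exact hr.le
  · have habs : Absorbent ℝ {x | N x ≤ 1} := by
      rw [← N.closedBall_zero_eq]
      exact N.absorbent_closedBall_zero one_pos
    refine le_of_forall_gt_imp_ge_of_dense fun r hr => ?_
    obtain ⟨b, hb0, hbr, y, hy, rfl⟩ := exists_lt_of_gauge_lt habs hr
    rw [map_smul_eq_mul, Real.norm_of_nonneg hb0.le]
    exact (mul_le_of_le_one_right hb0.le hy).trans hbr.le

theorem IsDualPair.polarBody_eq (h : IsDualPair N N') :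
    polarBody {x | N x ≤ 1} = {p | N' p ≤ 1} := by
  ext p
  refine ⟨fun hp => ?_, fun hp q hq => (h.inner_le_of_le hp q).trans hq⟩
  obtain ⟨q, hq, hqp⟩ := h.attained' p
  rw [Set.mem_ofPred_eq, ← hqp, real_inner_comm]
  exact hp q hq

theorem IsDualPair.bodyNorm_eq (h : IsDualPair N N') : bodyNorm {p | N' p ≤ 1} = N := by
  ext q
  refine IsGreatest.csSup_eq ⟨h.attained q, ?_⟩
  rintro _ ⟨p, hp, rfl⟩
  exact h.inner_le_of_le hp q

/-- For a norming `g`, the function `N - ⟨g, ·⟩` is nonnegative and vanishes at `q`, so its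
derivative there is zero. -/
theorem IsDualPair.isNormal_of_hasGradientAt (h : IsDualPair N N') {q ν : Space n}
    (hg : HasGradientAt N ν q) : IsNormal N N' q ν := by
  have key : ∀ g : Space n, N' g ≤ 1 → inner ℝ g q = N q → g = ν := fun g hg1 hgq => by
    have h1 : HasFDerivAt (fun x => N x - innerSL ℝ g x)
        (InnerProductSpace.toDual ℝ _ ν - innerSL ℝ g) q :=
      hg.hasFDerivAt.sub (innerSL ℝ g).hasFDerivAt
    have h2 : IsLocalMin (fun x => N x - innerSL ℝ g x) q := Filter.Eventually.of_forall fun x => by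
      have := h.inner_le_of_le hg1 x
      simp only [innerSL_apply_apply, hgq]
      linarith
    have h3 := h2.hasFDerivAt_eq_zero h1
    rw [sub_eq_zero] at h3
    refine ext_inner_right ℝ fun w => ?_
    have h4 := congrArg (fun f => f w) h3
    simpa using h4.symm
  obtain ⟨g, hg1, hgq⟩ := h.attained q
  obtain rfl := key g hg1 hgq
  exact ⟨hg1, hgq, key⟩

theorem IsDualPair.isNormal_of_smooth (h : IsDualPair N N') {q ν : Space n}
    (hq : IsSmoothBoundaryPointWithNormal {x | N x ≤ 1} q ν) : N q = 1 ∧ IsNormal N N' q ν := by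
  obtain ⟨h1, h2⟩ := hq
  rw [h.polarBody_eq, h.bodyNorm_eq] at h2
  exact ⟨frontier_le_subset_eq h.cont continuous_const h1, h.isNormal_of_hasGradientAt h2⟩

theorem IsHanner.exists_seminorms {H : Set (Space n)} (hH : IsHanner H) :
    ∃ N N' : Seminorm ℝ (Space n), IsDualPair N N' ∧ H = {x | N x ≤ 1} ∧ BounceRigid N N' := by
  induction hH with
  | segment =>
    refine ⟨_, _, isDualPair_norm one_pos, ?_, bounceRigid_norm_one⟩
    ext x
    rw [Set.mem_ofPred_eq, Set.mem_ofPred_eq, coe_normSeminorm, norm_space_one, abs_le]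
    rfl
  | sumOne _ _ ihK ihL =>
    obtain ⟨N, N', hN, rfl, hSN⟩ := ihK
    obtain ⟨M, M', hM, rfl, hSM⟩ := ihL
    refine ⟨_, _, (hN.symm.max hM.symm).symm, ?_, hSN.sum hN hM hSM⟩
    rw [HannerBilliard.sumOne, gauge_unitBody, gauge_unitBody]
    rfl
  | sumInfty _ _ ihK ihL =>
    obtain ⟨N, N', hN, rfl, hSN⟩ := ihK
    obtain ⟨M, M', hM, rfl, hSM⟩ := ihL
    refine ⟨_, _, hN.max hM, ?_, hSN.max hN hM hSM⟩
    rw [HannerBilliard.sumInfty, gauge_unitBody, gauge_unitBody]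
    rfl

end Bodies

/-- Time is the length covered, as velocities have norm `1`. The momentum is shifted by one: a
trajectory indexes it by arrival, an orbit by departure. -/
theorem IsDualPair.isOrbit {n : ℕ} {N N' : Seminorm ℝ (Space n)} (h : IsDualPair N N') {m : ℕ}
    [NeZero m] {q p : ZMod m → Space n}
    (ht : IsClassicalTrajectory {x | N x ≤ 1} {x | N' x ≤ 1} q p) :
    IsOrbit N N' (fun _ => True) (fun i : ℕ => q i) (fun i : ℕ => p (i + 1))
      (fun i => ∑ j ∈ Finset.range i, N (q (j + 1) - q j)) m
      (∑ j ∈ Finset.range m, N (q (j + 1) - q j)) 1 := by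
  have hmove : ∀ i : ZMod m, N' (p (i + 1)) = 1 ∧ ∃ v, IsNormal N' N (p (i + 1)) v ∧
      0 < N (q (i + 1) - q i) ∧ q (i + 1) - q i = N (q (i + 1) - q i) • v := fun i => by
    obtain ⟨v, hv, c, hc, h1⟩ := ht.coordinate_step i
    obtain ⟨h2, h3⟩ := h.symm.isNormal_of_smooth hv
    have h4 : N (q (i + 1) - q i) = c := by
      rw [h1, map_smul_eq_mul, Real.norm_of_nonneg hc.le, h3.eq_one h.symm, mul_one]
    exact ⟨h2, v, h3, h4.symm ▸ hc, h4.symm ▸ h1⟩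
  refine ⟨strictMono_nat_of_lt_succ fun i => ?_, NeZero.pos m, fun i => ?_, fun i => ?_, fun i => ?_,
    fun _ => Iff.rfl, fun i => (hmove i).1, fun i => ?_, fun i _ => ?_, fun i hi => (hi trivial).elim⟩
  · obtain ⟨-, v, -, h1, -⟩ := hmove i
    rw [Finset.sum_range_succ]
    linarith
  · simp
  · simp
  · rw [add_comm i, Finset.sum_range_add, add_comm]
    simp
  · obtain ⟨-, v, h1, -, h2⟩ := hmove i
    refine ⟨v, h1, ?_⟩
    rw [Finset.sum_range_succ, add_sub_cancel_left, Nat.cast_succ]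
    exact h2
  · obtain ⟨ν, hν, c, hc, h1⟩ := ht.momentum_step (i + 1)
    rw [Nat.cast_succ]
    obtain ⟨h2, h3⟩ := h.isNormal_of_smooth hν
    exact ⟨h2, ν, h3, c, hc, h1⟩

theorem trajectoryLength_eq_sum_range {n m : ℕ} [NeZero m] (T : Set (Space n))
    (q : ZMod m → Space n) :
    trajectoryLength T q = ∑ j ∈ Finset.range m, bodyNorm T (q (j + 1) - q j) := by
  refine Finset.sum_nbij' ZMod.val (fun j => (j : ZMod m)) (fun i _ => ?_) (fun _ _ => ?_)
    (fun i _ => ZMod.natCast_zmod_val i) (fun j hj => ?_) (fun i _ => ?_)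
  · exact Finset.mem_range.2 (ZMod.val_lt i)
  · exact Finset.mem_univ _
  · exact ZMod.val_cast_of_lt (Finset.mem_range.1 hj)
  · rw [ZMod.natCast_zmod_val]

end HannerBilliard

theorem mainTheorem1 (n : ℕ) (H : Set (HannerBilliard.Space n)) (hH : HannerBilliard.IsHanner H)
    (m : ℕ) [NeZero m] (q p : ZMod m → HannerBilliard.Space n)
    (htraj : HannerBilliard.IsClassicalTrajectory H (HannerBilliard.polarBody H) q p)
    (hsimple : HannerBilliard.IsSimpleTrajectory q p) :
    HannerBilliard.trajectoryLength (HannerBilliard.polarBody H) q = 4 ∧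
      m = 2 * n ∧
      (∀ i : ZMod m, q i = -q (i + (n : ZMod m))) ∧
      (∀ i : ZMod m, p i = -p (i + (n : ZMod m))) := by
  obtain ⟨N, N', hd, rfl, hS⟩ := hH.exists_seminorms
  rw [hd.polarBody_eq] at htraj ⊢
  obtain ⟨h1, h2⟩ := hS _ _ _ _ _ (hd.isOrbit htraj)
  have hq : ∀ i : ZMod m, q (i + n) = -q i := fun i => by
    obtain ⟨a, rfl⟩ := ZMod.natCast_zmod_surjective i
    rw [← Nat.cast_add]
    exact (h1 a).1
  have hp : ∀ i : ZMod m, p (i + n) = -p i := fun i => by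
    obtain ⟨a, ha⟩ := ZMod.natCast_zmod_surjective (i - 1)
    have h3 := (h1 a).2.1
    rw [Nat.cast_add, ha] at h3
    rwa [sub_add_cancel, sub_add_eq_add_sub, sub_add_cancel] at h3
  have hm : m = 2 * n := by
    refine Nat.dvd_antisymm ?_ h2
    rw [← ZMod.natCast_eq_zero_iff]
    refine hsimple _ fun i => ?_
    rw [Nat.cast_mul, Nat.cast_two, two_mul, ← add_assoc, hq, hq, hp, hp, neg_neg, neg_neg]
    exact ⟨rfl, rfl⟩
  refine ⟨?_, hm, fun i => by rw [hq, neg_neg], fun i => by rw [hp, neg_neg]⟩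
  have h3 := (h1 0).2.2
  have h4 := (h1 n).2.2
  rw [zero_add] at h3
  rw [HannerBilliard.trajectoryLength_eq_sum_range, hd.bodyNorm_eq,
    congrArg Finset.range (hm.trans (two_mul n)), h4, h3, Finset.sum_range_zero]
  norm_num
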